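/- Throughout, a quasiprojective variety over a field $K$ is an integral $K$-scheme that is isomorphic over $K$ to a locally closed subscheme of some projective space $\mathbb P^n_K$. If $R$ is a local ring with a homomorphism $R\to K$ to a field, $k$ is its residue field and $\mathcal X$ is an $R$-scheme, then $\mathcal X\times_R K$ is the generic fiber and $\overline{\mathcal X}=\mathcal X\times_R k$ the special fiber of $\mathcal X$; base extension gives the reduction map $r:\mathcal X(R)\to\overline{\mathcal X}(k)$ and, once the generic fiber is identified with a $K$-scheme $X$, a map $\iota:\mathcal X(R)\to X(K)$. (1) Let $(K_v,|\cdot|_v)$ be a finite extension of $\mathbb Q_p$ and let $\mathfrak o_v=\{x\in K_v : |x|_v\le 1\}$. Let $X$ be a quasiprojective variety over $K_v$ and let $\mathcal X$ be an $\mathfrak o_v$-scheme, locally of finite type, whose generic fiber is isomorphic to $X$ over $K_v$. Let $\alpha\in\mathcal X(\mathfrak o_v)$ be such that $\iota(\alpha)$ is a smooth point of $X$, and let $U_{\bar\alpha}=\{\beta\in\mathcal X(\mathfrak o_v) : r(\beta)=r(\alpha)\}$. Then $U=\iota(U_{\bar\alpha})\subseteq X(K_v)$ is Zariski dense in $X$.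 (2) Let $K$ be a number field with ring of integers $\mathfrak o_K$, let $v$ be a nonarchimedean place of $K$, and let $(\mathfrak o_K)_v\subset K$ be the localization of $\mathfrak o_K$ at (the prime ideal of) $v$. Let $X$ be a quasiprojective variety over $K$ and let $\mathcal X$ be an $(\mathfrak o_K)_v$-scheme, locally of finite type, whose generic fiber is isomorphic to $X$ over $K$. Let $\alpha\in\mathcal X((\mathfrak o_K)_v)$ be such that $\iota(\alpha)$ is a smooth point of $X$, and let $\alpha_v\in\overline{\mathcal X}$ be the point of the special fiber given by $r(\alpha)$. Let $U$ be the set of all $y\in X(\overline K)$ such that the Zariski closure in $\mathcal X$ of (the image of) $y$ contains $\alpha_v$. Then $U$ is Zariski dense in $X$. -/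

import Mathlib

open CategoryTheory CategoryTheory.Limits AlgebraicGeometry

universe u

noncomputable section

namespace DenseResidueClass

/-- `Spec B ⟶ Spec A` for an `A`-algebra `B`. -/
abbrev specMap (A B : Type u) [CommRing A] [CommRing B] [Algebra A B] :
    Spec (CommRingCat.of B) ⟶ Spec (CommRingCat.of A) :=
  Spec.map (CommRingCat.ofHom (algebraMap A B))

section ProjectiveSpace

attribute [local instance] MvPolynomial.gradedAlgebra

/-- Projective `n`-space over a commutative ring `A`, as `Proj A[x₀, …, xₙ]`. -/
abbrev projectiveSpace (A : Type u) [CommRing A] (n : ℕ) : Scheme.{u} :=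
  Proj (MvPolynomial.homogeneousSubmodule (Fin (n + 1)) A)

/-- The structure morphism of projective space. -/
def projectiveSpaceHom (A : Type u) [CommRing A] (n : ℕ) :
    projectiveSpace A n ⟶ Spec (CommRingCat.of A) :=
  Proj.toSpecZero (MvPolynomial.homogeneousSubmodule (Fin (n + 1)) A) ≫
    Spec.map (CommRingCat.ofHom
      (algebraMap A (MvPolynomial.homogeneousSubmodule (Fin (n + 1)) A 0)))

end ProjectiveSpace

/-- A quasiprojective variety over a field `K`: an integral `K`-scheme which is a locally closed
subscheme of some projective space over `K`. -/
structure IsQuasiProjectiveVariety {K : Type u} [Field K] {X : Scheme.{u}}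
    (f : X ⟶ Spec (CommRingCat.of K)) : Prop where
  isIntegral : IsIntegral X
  exists_immersion : ∃ (n : ℕ) (i : X ⟶ projectiveSpace K n),
    IsImmersion i ∧ i ≫ projectiveSpaceHom K n = f

/-- `B`-valued points of an `A`-scheme `X`, for an `A`-algebra `B`. -/
@[ext]
structure Points {A : Type u} [CommRing A] {X : Scheme.{u}} (f : X ⟶ Spec (CommRingCat.of A))
    (B : Type u) [CommRing B] [Algebra A B] : Type u where
  hom : Spec (CommRingCat.of B) ⟶ X
  hom_comp : hom ≫ f = specMap A B

/-- The point of the underlying topological space of `X` that carries an `L`-valued point,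
`L` a field. -/
def Points.pt {A : Type u} [CommRing A] {X : Scheme.{u}} {f : X ⟶ Spec (CommRingCat.of A)}
    {L : Type u} [Field L] [Algebra A L] (y : Points f L) : X :=
  y.hom (IsLocalRing.closedPoint L)

/-- A set of `L`-valued points is Zariski dense in `X` if no proper closed subset of `X`
contains it. -/
def IsZariskiDense {A : Type u} [CommRing A] {X : Scheme.{u}} {f : X ⟶ Spec (CommRingCat.of A)}
    {L : Type u} [Field L] [Algebra A L] (U : Set (Points f L)) : Prop :=
  Dense (Points.pt '' U)

/-- `X` is smooth over the base of `f` at the point `x`. -/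
def IsSmoothAt {X S : Scheme.{u}} (f : X ⟶ S) (x : X) : Prop :=
  ∃ V : X.Opens, x ∈ V ∧ Smooth (V.ι ≫ f)

/-- The base change `X_B` of an `A`-scheme `X` to an `A`-algebra `B`. -/
abbrev baseChange {A : Type u} [CommRing A] {X : Scheme.{u}} (f : X ⟶ Spec (CommRingCat.of A))
    (B : Type u) [CommRing B] [Algebra A B] : Scheme.{u} :=
  pullback f (specMap A B)

/-- The structure morphism `X_B ⟶ Spec B`. -/
abbrev baseChangeHom {A : Type u} [CommRing A] {X : Scheme.{u}}
    (f : X ⟶ Spec (CommRingCat.of A)) (B : Type u) [CommRing B] [Algebra A B] :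
    baseChange f B ⟶ Spec (CommRingCat.of B) :=
  pullback.snd f (specMap A B)

/-- The projection `X_B ⟶ X`. -/
abbrev baseChangeProj {A : Type u} [CommRing A] {X : Scheme.{u}}
    (f : X ⟶ Spec (CommRingCat.of A)) (B : Type u) [CommRing B] [Algebra A B] :
    baseChange f B ⟶ X :=
  pullback.fst f (specMap A B)

theorem specMap_self (A : Type u) [CommRing A] : specMap A A = 𝟙 _ :=
  Spec.map_id _

/-- The map `X(A) → X_B(B)` given by base extension. -/
def Points.baseChange {A : Type u} [CommRing A] {X : Scheme.{u}}
    {f : X ⟶ Spec (CommRingCat.of A)} (y : Points f A)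
    (B : Type u) [CommRing B] [Algebra A B] : Points (baseChangeHom f B) B :=
  ⟨pullback.lift (specMap A B ≫ y.hom) (𝟙 _) (by
      rw [Category.assoc, y.hom_comp, specMap_self, Category.comp_id, Category.id_comp]), by
    rw [pullback.lift_snd, specMap_self]⟩

/-- An isomorphism over `K` from the `K`-scheme `X` to the generic fiber of the
`R`-scheme `𝒳`. -/
structure GenericFiberIso {R K : Type u} [CommRing R] [Field K] [Algebra R K]
    {𝒳 : Scheme.{u}} (g : 𝒳 ⟶ Spec (CommRingCat.of R))
    {X : Scheme.{u}} (f : X ⟶ Spec (CommRingCat.of K)) where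
  iso : X ≅ baseChange g K
  hom_comp : iso.hom ≫ baseChangeHom g K = f

theorem GenericFiberIso.inv_comp {R K : Type u} [CommRing R] [Field K] [Algebra R K]
    {𝒳 : Scheme.{u}} {g : 𝒳 ⟶ Spec (CommRingCat.of R)}
    {X : Scheme.{u}} {f : X ⟶ Spec (CommRingCat.of K)} (e : GenericFiberIso g f) :
    e.iso.inv ≫ f = baseChangeHom g K := by
  rw [Iso.inv_comp_eq, e.hom_comp]

section Model

variable {R K : Type u} [CommRing R] [IsLocalRing R] [Field K] [Algebra R K]
  {𝒳 : Scheme.{u}} {g : 𝒳 ⟶ Spec (CommRingCat.of R)}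
  {X : Scheme.{u}} {f : X ⟶ Spec (CommRingCat.of K)}

/-- The special fiber of the scheme `𝒳` over the local ring `R`. -/
abbrev specialFiber (g : 𝒳 ⟶ Spec (CommRingCat.of R)) : Scheme.{u} :=
  baseChange g (IsLocalRing.ResidueField R)

/-- The reduction map from `𝒳(R)` to the rational points of the special fiber. -/
abbrev reduction (α : Points g R) :
    Points (baseChangeHom g (IsLocalRing.ResidueField R)) (IsLocalRing.ResidueField R) :=
  α.baseChange (IsLocalRing.ResidueField R)

/-- The map `ι : 𝒳(R) → X(K)` given by base extension, the generic fiber of `𝒳` being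
identified with `X`. -/
def genericPt (e : GenericFiberIso g f) (α : Points g R) : Points f K :=
  ⟨(α.baseChange K).hom ≫ e.iso.inv, by
    rw [Category.assoc, e.inv_comp, (α.baseChange K).hom_comp]⟩

/-- The residue class of `α`: all `β ∈ 𝒳(R)` with the same reduction as `α`. -/
def residueClass (α : Points g R) : Set (Points g R) :=
  { β | reduction α = reduction β }

/-- The points `y ∈ X(L)`, for a field `L` over `K`, for which the Zariski closure of `y` in `𝒳`
contains the point of the special fiber that is the reduction of `α`. -/
def specializingPoints (e : GenericFiberIso g f) (α : Points g R)
    (L : Type u) [Field L] [Algebra K L] : Set (Points f L) :=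
  { y | baseChangeProj g (IsLocalRing.ResidueField R) (reduction α).pt ∈
      closure {baseChangeProj g K (e.iso.hom y.pt)} }

end Model

end DenseResidueClass

end

/-! Near a smooth rational point, `X` looks like a ball in affine space. Let `L` be `K` itself in
the local case and the `v`-adic completion of `K` in the global case. On a standard smooth chart
`Spec B` around `ι(α)`, some coordinates are free and the Jacobian of the relations in the others is
invertible, so every value of the free coordinates close to that of `α` lifts to an `L`-point close
to `α` (`eventually_exists_algHom`).

To land in a given nonempty open set, a nonzero `h : B` must not vanish at the lift. Since `B` is
algebraic over the polynomial ring in the free coordinates, `h` divides a nonzero polynomial `q` in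
them, and `q` is nonzero at `K`-points arbitrarily close to any given one
(`exists_near_eval_ne_zero`). Together this is `exists_algHom_near`, put into charts of `X` and `𝒳`
by `exists_near_point`.

The absolute value is ultrametric, so distance `< 1` on generators of a chart of `𝒳` gives distance
`< 1` on all functions. In the local case the new point is therefore integral with the same
reduction as `α`. In the global case its free coordinates lie in `K`, so unramifiedness makes all
its coordinates algebraic over `K`; a function vanishing at it has norm `< 1` at `α`, which is the
required specialization. -/

noncomputable section

namespace DenseResidueClass

open Topology

section AffineLocal

open MvPolynomial

/-! ### Nearby zeros of the relations of a smooth algebra -/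

section Polynomial

variable {K L ι : Type*} [Field K] [NontriviallyNormedField L] [Algebra K L] [Fintype ι]

theorem hasStrictFDerivAt_aeval (p : MvPolynomial ι K) (x : ι → L) :
    HasStrictFDerivAt (fun y : ι → L => aeval y p)
      (∑ i, aeval x (pderiv i p) • ContinuousLinearMap.proj (R := L) (φ := fun _ : ι => L) i) x := by
  classical
  induction p using MvPolynomial.induction_on with
  | C a =>
    refine ((hasStrictFDerivAt_const (𝕜 := L) (algebraMap K L a) x).congr_fderiv
      ?_).congr_of_eventuallyEq (Filter.Eventually.of_forall fun y => (aeval_C y a).symm)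
    ext v
    simp
  | add p q hp hq =>
    refine ((hp.add hq).congr_fderiv ?_).congr_of_eventuallyEq
      (Filter.Eventually.of_forall fun y => (map_add (aeval y) p q).symm)
    ext v
    simp [add_mul, Finset.sum_add_distrib]
  | mul_X p j hp =>
    have hj : HasStrictFDerivAt (fun y : ι → L => y j)
        (ContinuousLinearMap.proj (R := L) (φ := fun _ : ι => L) j) x :=
      (ContinuousLinearMap.proj (R := L) (φ := fun _ : ι => L) j).hasStrictFDerivAt
    refine ((hp.mul hj).congr_fderiv ?_).congr_of_eventuallyEq
      (Filter.Eventually.of_forall fun y => by simp)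
    ext v
    simp [Derivation.leibniz, pderiv_X, Pi.single_apply, add_mul, Finset.sum_add_distrib,
      Finset.mul_sum, apply_ite, mul_assoc]

end Polynomial

section Smooth

variable {K L B ι σ : Type*} [Field K] [NontriviallyNormedField L] [Algebra K L]
  [CommRing B] [Algebra K B] [Finite σ] (P : Algebra.SubmersivePresentation K B ι σ)

/-- An algebra homomorphism out of a presented algebra, from a zero of the relations. -/
theorem exists_algHom_of_aeval_relation_eq_zero {S : Type*} [CommRing S] [Algebra K S]
    (x : ι → S) (hx : ∀ j, aeval x (P.relation j) = 0) :
    ∃ β : B →ₐ[K] S, ∀ i, β (P.val i) = x i := by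
  have hs : Function.Surjective (aeval (R := K) P.val) := P.aeval_val_surjective
  have hk : RingHom.ker (aeval (R := K) P.val) ≤ RingHom.ker (aeval (R := K) x) := by
    have := P.span_range_relation_eq_ker
    rw [Algebra.Generators.ker_eq_ker_aeval_val] at this
    rw [← this, Ideal.span_le]
    rintro _ ⟨j, rfl⟩
    exact hx j
  refine ⟨AlgHom.liftOfSurjective _ hs _ hk, fun i => ?_⟩
  simpa using AlgHom.liftOfSurjective_apply _ hs _ hk (X i)

/-- The coordinates that are not eliminated by the relations of a submersive presentation. -/
abbrev freeCoord (P : Algebra.SubmersivePresentation K B ι σ)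
    (d : ((Set.range P.map)ᶜ : Set ι)) : B := P.val d

/-- The differential of the relations together with the free coordinates is surjective. -/
theorem exists_jacobian_apply_eq [Fintype ι] (α : B →ₐ[K] L) (u : σ → L)
    (w : ((Set.range P.map)ᶜ : Set ι) → L) :
    ∃ v : ι → L, (∀ j, ∑ i, α (aeval P.val (pderiv i (P.relation j))) * v i = u j) ∧
      ∀ d : ((Set.range P.map)ᶜ : Set ι), v d = w d := by
  classical
  cases nonempty_fintype σ
  -- The Jacobian is a unit of `B`, hence stays invertible at the point `α`.
  have hJ : IsUnit (α.toRingHom.mapMatrix ((aeval P.val).mapMatrix P.jacobiMatrix)) := by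
    have h := P.jacobian_isUnit
    rw [P.jacobian_eq_jacobiMatrix_det, P.algebraMap_eq, ← RingHom.coe_coe, RingHom.map_det,
      ← Matrix.isUnit_iff_isUnit_det] at h
    exact h.map α.toRingHom.mapMatrix
  set M := α.toRingHom.mapMatrix ((aeval P.val).mapMatrix P.jacobiMatrix) with hM
  -- Put `w` on the free coordinates; `u'` is the part of `u` still missing, to be supplied by the
  -- eliminated coordinates through the invertible square system.
  let w' : ι → L := fun i => if h : i ∈ (Set.range P.map)ᶜ then w ⟨i, h⟩ else 0
  let u' : σ → L := fun j => u j - ∑ i, α (aeval P.val (pderiv i (P.relation j))) * w' i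
  obtain ⟨z, hz⟩ : ∃ z : σ → L, Matrix.vecMul z M = u' :=
    (Matrix.vecMul_surjective_iff_isUnit.2 hJ) u'
  let z' : ι → L := Function.extend P.map z 0
  refine ⟨w' + z', fun j => ?_, fun d => ?_⟩
  · have h1 : ∑ i, α (aeval P.val (pderiv i (P.relation j))) * z' i = u' j := by
      rw [← hz, Matrix.vecMul, dotProduct]
      symm
      refine Finset.sum_of_injOn P.map P.map_inj.injOn (by simp) (fun i _ hi => ?_)
        (fun i _ => ?_)
      · have : z' i = 0 := Function.extend_apply' _ _ _ (by simpa using hi)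
        rw [this, mul_zero]
      · simp only [z', P.map_inj.extend_apply, hM]
        simp [mul_comm,
          Algebra.PreSubmersivePresentation.jacobiMatrix_apply]
    simp only [Pi.add_apply, mul_add, Finset.sum_add_distrib, h1, u']
    ring
  · have : z' d = 0 := Function.extend_apply' _ _ _ d.2
    simp only [Pi.add_apply, this, add_zero, w', dif_pos d.2]

/-- Relations and free coordinates together form a map with surjective strict derivative at `α`, so
it sends neighbourhoods to neighbourhoods. Slicing the image at relations equal to zero gives points
of `Spec B`. -/
theorem eventually_exists_algHom [CompleteSpace L] [Finite ι] (α : B →ₐ[K] L) (F : Finset B)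
    {ε : ℝ} (hε : 0 < ε) :
    ∀ᶠ s in 𝓝 (fun d => α (freeCoord P d)), ∃ β : B →ₐ[K] L,
      (∀ d, β (freeCoord P d) = s d) ∧ ∀ a ∈ F, ‖β a - α a‖ < ε := by
  classical
  cases nonempty_fintype ι
  cases nonempty_fintype σ
  let x₀ : ι → L := fun i => α (P.val i)
  have hx₀ : ∀ p, aeval x₀ p = α (aeval P.val p) := fun p => by
    rw [← AlgHom.comp_apply, comp_aeval]
  let Φ : (ι → L) → (σ → L) × (((Set.range P.map)ᶜ : Set ι) → L) :=
    fun x => (fun j => aeval x (P.relation j), fun d => x d)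
  let Φ' : (ι → L) →L[L] (σ → L) × (((Set.range P.map)ᶜ : Set ι) → L) :=
    (ContinuousLinearMap.pi fun j => ∑ i, aeval x₀ (pderiv i (P.relation j)) •
      ContinuousLinearMap.proj (R := L) (φ := fun _ : ι => L) i).prod
    (ContinuousLinearMap.pi fun d => ContinuousLinearMap.proj (R := L) (φ := fun _ : ι => L) d.1)
  have hΦ : HasStrictFDerivAt Φ Φ' x₀ :=
    (hasStrictFDerivAt_pi.2 fun j => hasStrictFDerivAt_aeval _ _).prodMk
      (hasStrictFDerivAt_pi.2 fun d =>
        (ContinuousLinearMap.proj (R := L) (φ := fun _ : ι => L) d.1).hasStrictFDerivAt)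
  have hsurj : Φ'.range = ⊤ := by
    rw [LinearMap.range_eq_top]
    rintro ⟨u, w⟩
    obtain ⟨v, hv, hw⟩ := exists_jacobian_apply_eq P α u w
    refine ⟨v, Prod.ext (funext fun j => ?_) (funext fun d => ?_)⟩
    · simpa [Φ', hx₀] using hv j
    · simpa [Φ'] using hw d
  have hmap := hΦ.map_nhds_eq_of_surj hsurj
  have hΦ₀ : Φ x₀ = (0, fun d => α (freeCoord P d)) := by
    refine Prod.ext (funext fun j => ?_) rfl
    simp [Φ, hx₀]
  -- Each `a ∈ F` is represented by the polynomial `P.σ a`, which is continuous in the coordinates.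
  have hN : ∀ᶠ x in 𝓝 x₀, ∀ a ∈ F, ‖aeval x (P.σ a) - α a‖ < ε := by
    refine (Filter.eventually_all_finset F).2 fun a _ => ?_
    have hc : ContinuousAt (fun x : ι → L => ‖aeval x (P.σ a) - α a‖) x₀ :=
      ((hasStrictFDerivAt_aeval (P.σ a) x₀).continuousAt.sub continuousAt_const).norm
    refine hc.eventually_lt continuousAt_const ?_
    simpa [hx₀] using hε
  have him := Filter.image_mem_map (m := Φ) hN
  rw [hmap, hΦ₀] at him
  have ht : Filter.Tendsto (fun s : ((Set.range P.map)ᶜ : Set ι) → L => ((0 : σ → L), s))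
      (𝓝 fun d => α (freeCoord P d)) (𝓝 (0, fun d => α (freeCoord P d))) :=
    (Continuous.prodMk_right _).tendsto _
  filter_upwards [ht him] with s hs
  obtain ⟨x, hxF, hx⟩ := hs
  obtain ⟨β, hβ⟩ := exists_algHom_of_aeval_relation_eq_zero P x
    fun j => congrFun (congrArg Prod.fst hx) j
  refine ⟨β, fun d => (hβ d).trans (congrFun (congrArg Prod.snd hx) d), fun a ha => ?_⟩
  have : aeval x (P.σ a) = β a := by
    have h2 : (aeval x : MvPolynomial ι K →ₐ[K] L) = β.comp (aeval P.val) := by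
      ext i; simp [hβ]
    rw [h2, AlgHom.comp_apply]
    congr 1
    exact P.aeval_val_σ a
  rw [← this]
  exact hxF a ha

/-- A nonzero polynomial over `K` is nonzero at `K`-points arbitrarily close to a given one. -/
theorem exists_near_eval_ne_zero {D : Type*} [Finite D] (π : K) (hπ₀ : π ≠ 0)
    (hπ : ‖algebraMap K L π‖ < 1) (t : D → K) (q : MvPolynomial D K) (hq : q ≠ 0)
    {p : (D → L) → Prop} (hp : ∀ᶠ s in 𝓝 (fun d => algebraMap K L (t d)), p s) :
    ∃ s : D → K, p (fun d => algebraMap K L (s d)) ∧ eval s q ≠ 0 := by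
  cases nonempty_fintype D
  obtain ⟨δ, hδ, hball⟩ := Metric.eventually_nhds_iff.1 hp
  let S : D → Set K := fun d => {c | ‖algebraMap K L c - algebraMap K L (t d)‖ < δ}
  -- The elements `t d + π ^ (N + n)` are distinct and close to `t d`. A polynomial vanishing on a
  -- product of infinite sets is zero.
  have hS : ∀ d, (S d).Infinite := fun d => by
    obtain ⟨N, hN⟩ := exists_pow_lt_of_lt_one hδ hπ
    have hπi : Function.Injective fun n : ℕ => π ^ n := by
      intro m n hmn
      have h0 : 0 < ‖algebraMap K L π‖ := by simpa using hπ₀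
      have : ‖algebraMap K L π‖ ^ m = ‖algebraMap K L π‖ ^ n := by
        simpa using congrArg (fun z => ‖algebraMap K L z‖) hmn
      exact pow_right_injective₀ h0 hπ.ne this
    have hi : Function.Injective fun n : ℕ => t d + π ^ (N + n) := fun m n hmn => by
      simpa using hπi (add_left_cancel hmn)
    refine (Set.infinite_range_of_injective hi).mono ?_
    rintro _ ⟨n, rfl⟩
    have : ‖algebraMap K L π‖ ^ (N + n) ≤ ‖algebraMap K L π‖ ^ N :=
      pow_le_pow_of_le_one (norm_nonneg _) hπ.le (Nat.le_add_right _ _)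
    simpa [S] using this.trans_lt hN
  by_contra! hcon
  refine hq (funext_set S hS fun s hs => ?_)
  rw [map_zero]
  refine hcon s (hball ?_)
  rw [dist_pi_lt_iff hδ]
  intro d
  rw [dist_eq_norm]
  exact hs d trivial

end Smooth

/-! ### Algebraicity over the free coordinates -/

section Unramified

variable {K B ι σ : Type*} [Field K] [CommRing B] [Algebra K B] [Finite σ]
  (P : Algebra.SubmersivePresentation K B ι σ)

/-- The differentials of the free coordinates form a basis of `Ω[B⁄K]` and die in `Ω[B⁄A]`; as the
first module surjects onto the second, `Ω[B⁄A]` vanishes. -/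
theorem formallyUnramified_freeCoord [Algebra (MvPolynomial ((Set.range P.map)ᶜ : Set ι) K) B]
    [IsScalarTower K (MvPolynomial ((Set.range P.map)ᶜ : Set ι) K) B]
    (h : ∀ d, algebraMap (MvPolynomial ((Set.range P.map)ᶜ : Set ι) K) B (X d) = freeCoord P d) :
    Algebra.FormallyUnramified (MvPolynomial ((Set.range P.map)ᶜ : Set ι) K) B := by
  let A := MvPolynomial ((Set.range P.map)ᶜ : Set ι) K
  refine ⟨?_⟩
  have hz : KaehlerDifferential.map K A B B = 0 := by
    have hz' : (KaehlerDifferential.map K A B B) = (0 : Ω[B⁄K] →ₗ[B] Ω[B⁄A]) := by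
      refine P.basisKaehler.ext fun d => ?_
      rw [P.basisKaehler_apply, KaehlerDifferential.map_D]
      change KaehlerDifferential.D A B (freeCoord P d) = _
      rw [← h, Derivation.map_algebraMap, LinearMap.zero_apply]
    exact hz'
  have hs := KaehlerDifferential.map_surjective K A B
  refine subsingleton_of_forall_eq 0 fun y => ?_
  obtain ⟨x, rfl⟩ := hs y
  rw [hz]; rfl

/-- An algebra map between domains which is injective, unramified and essentially of finite type
is algebraic. -/
theorem isAlgebraic_of_formallyUnramified {A B : Type*} [CommRing A] [IsDomain A] [CommRing B]
    [IsDomain B] [Algebra A B] [FaithfulSMul A B] [Algebra.FormallyUnramified A B]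
    [Algebra.EssFiniteType A B] : Algebra.IsAlgebraic A B := by
  let F := FractionRing A
  let E := FractionRing B
  let : Algebra F E := FractionRing.liftAlgebra A E
  have h1 : Algebra.FormallyUnramified B E := .of_isLocalization (nonZeroDivisors B)
  have h2 : Algebra.FormallyUnramified A E := .comp A B E
  have h3 : Algebra.FormallyUnramified F E := .of_restrictScalars A F E
  have h4 : Algebra.EssFiniteType B E := .of_isLocalization _ (nonZeroDivisors B)
  have h5 : Algebra.EssFiniteType A E := .comp A B E
  have h6 : Algebra.EssFiniteType F E := .of_comp A F E
  have h7 : Algebra.IsSeparable F E := Algebra.FormallyUnramified.isSeparable F E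
  have h8 : Algebra.IsAlgebraic F E := inferInstance
  exact ((IsFractionRing.comap_isAlgebraic_iff (A := A) (K := F)
    (C := E)).2 h8).tower_bot_of_injective (FaithfulSMul.algebraMap_injective B E)

/-- If the free coordinates take values in the base field, then all values are algebraic. -/
theorem isAlgebraic_apply_of_freeCoord [Finite ι] {L : Type*} [Field L] [Algebra K L]
    (β : B →ₐ[K] L) (s : ((Set.range P.map)ᶜ : Set ι) → K)
    (hs : ∀ d, β (freeCoord P d) = algebraMap K L (s d)) (b : B) : IsAlgebraic K (β b) := by
  let A := MvPolynomial ((Set.range P.map)ᶜ : Set ι) K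
  let : Algebra A B := (aeval (freeCoord P)).toAlgebra
  have : IsScalarTower K A B := .of_algebraMap_eq fun x => by
    simp [RingHom.algebraMap_toAlgebra, A]
  have hu : Algebra.FormallyUnramified A B := formallyUnramified_freeCoord P fun d => by
    simp [RingHom.algebraMap_toAlgebra]
  -- The image `C` is unramified over `A`, and `A` acts on it through evaluation at `s` into `K`. So
  -- `C` is unramified and of finite type over the field `K`, hence finite.
  let C := β.range
  let : Algebra A C := (β.rangeRestrict.toRingHom.comp (algebraMap A B)).toAlgebra
  let φ : B →ₐ[A] C := { β.rangeRestrict.toRingHom with commutes' := fun _ => rfl }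
  have hC : Algebra.FormallyUnramified A C := .of_surjective φ β.rangeRestrict_surjective
  let : Algebra A K := (aeval s).toAlgebra
  have : IsScalarTower A K C := .of_algebraMap_eq' <| by
    have : (β.rangeRestrict.comp (aeval (freeCoord P)) : A →ₐ[K] C) =
        (Algebra.ofId K C).comp (aeval s) := by
      ext d
      simp [hs, Algebra.ofId_apply]
    exact congrArg AlgHom.toRingHom this
  have hK : Algebra.FormallyUnramified K C := .of_restrictScalars A K C
  have : Algebra.FiniteType K B := .of_surjective (aeval P.val) P.aeval_val_surjective
  have : Algebra.FiniteType K C := .of_surjective β.rangeRestrict β.rangeRestrict_surjective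
  have : Module.Finite K C := Algebra.FormallyUnramified.finite_of_free K C
  have hb : IsAlgebraic K (β.rangeRestrict b) := Algebra.IsAlgebraic.isAlgebraic _
  exact hb.algHom C.val

end Unramified

theorem exists_algHom_near {K B L : Type*} [Field K] [CommRing B] [Algebra K B] [IsDomain B]
    [Algebra.IsStandardSmooth K B] [NormedField L] [CompleteSpace L] [Algebra K L]
    (π : K) (hπ₀ : π ≠ 0) (hπ : ‖algebraMap K L π‖ < 1) (α : B →ₐ[K] K) (F : Finset B)
    {ε : ℝ} (hε : 0 < ε) {h : B} (hh : h ≠ 0) :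
    ∃ β : B →ₐ[K] L, (∀ a ∈ F, ‖β a - algebraMap K L (α a)‖ < ε) ∧ β h ≠ 0 ∧
      ∀ b, IsAlgebraic K (β b) := by
  let : NontriviallyNormedField L :=
    { ‹NormedField L› with
      non_trivial := ⟨(algebraMap K L π)⁻¹, by
        rw [norm_inv]
        exact (one_lt_inv₀ (by simpa using hπ₀)).2 hπ⟩ }
  obtain ⟨ι, σ, _, _, ⟨P⟩⟩ := Algebra.IsStandardSmooth.out (R := K) (S := B)
  let D := ((Set.range P.map)ᶜ : Set ι)
  let A := MvPolynomial D K
  let : Algebra A B := (aeval (freeCoord P)).toAlgebra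
  have hAB : ∀ q : A, algebraMap A B q = aeval (freeCoord P) q := fun q => rfl
  have : IsScalarTower K A B := .of_algebraMap_eq fun x => by simp [hAB, A]
  have hu : Algebra.FormallyUnramified A B :=
    formallyUnramified_freeCoord P fun d => aeval_X _ d
  have : Algebra.FiniteType K B := .of_surjective (aeval P.val) P.aeval_val_surjective
  have : Algebra.FiniteType A B := .of_restrictScalars_finiteType K A B
  have hev := eventually_exists_algHom P ((Algebra.ofId K L).comp α) F hε
  -- A nonzero polynomial killed in `B` would vanish at every lifted point, yet some nearby `s` that
  -- lifts avoids its zeros.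
  have hinj : Function.Injective (algebraMap A B) := by
    rw [injective_iff_map_eq_zero]
    intro q hq
    by_contra hq0
    obtain ⟨s, ⟨β, hβ, -⟩, hs⟩ :=
      exists_near_eval_ne_zero (L := L) π hπ₀ hπ (fun d => α (freeCoord P d)) q hq0 hev
    refine hs ((algebraMap K L).injective ?_)
    have h1 : β (aeval (freeCoord P) q) = 0 := by rw [← hAB, hq, map_zero]
    rw [← AlgHom.comp_apply, comp_aeval, funext hβ] at h1
    rw [map_zero, ← h1, ← coe_aeval_eq_eval]
    exact (aeval_algebraMap_apply (B := L) s q).symm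
  have : FaithfulSMul A B := (faithfulSMul_iff_algebraMap_injective A B).2 hinj
  have halg : Algebra.IsAlgebraic A B := isAlgebraic_of_formallyUnramified
  -- `h` divides the image of `q`, so `q` nonvanishing at `s` forces `β h ≠ 0`.
  obtain ⟨q, hq0, hq⟩ :=
    (halg.isAlgebraic h).exists_nonzero_dvd (mem_nonZeroDivisors_of_ne_zero hh)
  obtain ⟨s, ⟨β, hβ, hF⟩, hs⟩ :=
    exists_near_eval_ne_zero (L := L) π hπ₀ hπ (fun d => α (freeCoord P d)) q hq0 hev
  refine ⟨β, hF, fun h0 => hs ((algebraMap K L).injective ?_),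
    isAlgebraic_apply_of_freeCoord P β s hβ⟩
  have h1 : β (aeval (freeCoord P) q) = 0 := by
    rw [← hAB]
    exact zero_dvd_iff.1 (h0 ▸ map_dvd β hq)
  rw [← AlgHom.comp_apply, comp_aeval, funext hβ] at h1
  rw [map_zero, ← h1, ← coe_aeval_eq_eval]
  exact (aeval_algebraMap_apply (B := L) s q).symm

end AffineLocal

/-! ### Affine charts -/

theorem exists_finiteType_chart {R : Type u} [CommRing R] {X : Scheme.{u}}
    (g : X ⟶ Spec (CommRingCat.of R)) [LocallyOfFiniteType g] (x : X) :
    ∃ (A : CommRingCat.{u}) (φ : CommRingCat.of R ⟶ A) (i : Spec A ⟶ X), IsOpenImmersion i ∧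
      i ≫ g = Spec.map φ ∧ φ.hom.FiniteType ∧ x ∈ Set.range i := by
  obtain ⟨A, i, hi, hx, -⟩ :=
    Scheme.exists_affine_mem_range_and_range_subset (U := (⊤ : X.Opens)) (x := x) trivial
  refine ⟨A, Spec.preimage (i ≫ g), i, hi, (Spec.map_preimage _).symm, ?_, hx⟩
  rw [← HasRingHomProperty.Spec_iff (P := @LocallyOfFiniteType), Spec.map_preimage]
  infer_instance

theorem exists_standardSmooth_chart {K : Type u} [CommRing K] {X : Scheme.{u}}
    {f : X ⟶ Spec (CommRingCat.of K)} {x : X} (hx : IsSmoothAt f x) {O : X.Opens} (hO : x ∈ O) :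
    ∃ (B : CommRingCat.{u}) (ψ : CommRingCat.of K ⟶ B) (j : Spec B ⟶ X), IsOpenImmersion j ∧
      j ≫ f = Spec.map ψ ∧ ψ.hom.IsStandardSmooth ∧ x ∈ Set.range j ∧ Set.range j ⊆ O := by
  obtain ⟨V, hxV, hV⟩ := hx
  obtain ⟨B, i, hi, ⟨y, rfl⟩, hiV⟩ :=
    Scheme.exists_affine_mem_range_and_range_subset (U := V ⊓ O) (x := x) ⟨hxV, hO⟩
  have hVr : Set.range i ⊆ Set.range V.ι := by
    rw [Scheme.Opens.range_ι]
    exact fun z hz => (hiV hz).1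
  have hfac : i ≫ f = IsOpenImmersion.lift V.ι i hVr ≫ V.ι ≫ f := by
    rw [IsOpenImmersion.lift_fac_assoc]
  have hli : IsOpenImmersion (IsOpenImmersion.lift V.ι i hVr) := by
    have : IsOpenImmersion (IsOpenImmersion.lift V.ι i hVr ≫ V.ι) := by
      rwa [IsOpenImmersion.lift_fac]
    exact IsOpenImmersion.of_comp _ V.ι
  have hs : Smooth (i ≫ f) := by rw [hfac]; infer_instance
  let φ := Spec.preimage (i ≫ f)
  have hφ : φ.hom.Smooth := by
    rw [← HasRingHomProperty.Spec_iff (P := @Smooth), Spec.map_preimage]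
    exact hs
  obtain ⟨s, hspan, hloc⟩ := RingHom.smooth_iff_locally_isStandardSmooth.1 hφ
  -- The localizing elements generate the unit ideal, so one of them does not vanish at `y`.
  obtain ⟨r, hr, hry⟩ : ∃ r ∈ s, r ∉ y.asIdeal := by
    by_contra! hcon
    exact y.isPrime.ne_top (top_le_iff.1 (hspan ▸ Ideal.span_le.2 hcon))
  refine ⟨.of (Localization.Away r),
    φ ≫ CommRingCat.ofHom (algebraMap B (Localization.Away r)),
    Spec.map (CommRingCat.ofHom (algebraMap B (Localization.Away r))) ≫ i,
    inferInstance, ?_, hloc r hr, ?_, ?_⟩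
  · rw [Spec.map_comp, Spec.map_preimage, Category.assoc]
  · obtain ⟨z, hz⟩ : y ∈ Set.range (PrimeSpectrum.comap (algebraMap B (Localization.Away r))) := by
      rw [PrimeSpectrum.localization_away_comap_range (Localization.Away r) r]
      exact hry
    exact ⟨z, (Scheme.Hom.comp_apply _ i _).trans (congrArg i hz)⟩
  · rintro _ ⟨z, rfl⟩
    rw [Scheme.Hom.comp_apply]
    exact (hiV ⟨_, rfl⟩).2

/-- Every point of the spectrum of a local ring specializes to the closed point, so an open set
containing the image of the latter contains the whole image. -/
theorem exists_spec_map_of_closedPoint_mem {R : Type u} [CommRing R] [IsLocalRing R]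
    {X : Scheme.{u}} {A : CommRingCat.{u}} (i : Spec A ⟶ X) [IsOpenImmersion i]
    (y : Spec (CommRingCat.of R) ⟶ X) (hy : y (IsLocalRing.closedPoint R) ∈ Set.range i) :
    ∃ a : A ⟶ CommRingCat.of R, y = Spec.map a ≫ i := by
  have h : Set.range y ⊆ Set.range i := by
    rintro _ ⟨z, rfl⟩
    have := Scheme.preimage_eq_top_of_closedPoint_mem (f := y) (U := i.opensRange) hy
    exact (this.symm ▸ trivial : z ∈ y ⁻¹ᵁ i.opensRange)
  refine ⟨Spec.preimage (IsOpenImmersion.lift i y h), ?_⟩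
  rw [Spec.map_preimage, IsOpenImmersion.lift_fac]

/-! ### Norms and reduction -/

theorem mem_maximalIdeal_of_norm_lt_one {K L : Type*} [Field K] [NormedField L] [Algebra K L]
    {R : ValuationSubring K} (hR : ∀ x : K, x ∈ R ↔ ‖algebraMap K L x‖ ≤ 1) {r : R}
    (hr : ‖algebraMap K L r‖ < 1) : r ∈ IsLocalRing.maximalIdeal R := by
  rw [IsLocalRing.mem_maximalIdeal, mem_nonunits_iff]
  rintro ⟨u, rfl⟩
  have h1 := (hR _).1 (u⁻¹ : Rˣ).1.2
  have h2 : ‖algebraMap K L (u.1 : K)‖ * ‖algebraMap K L ((u⁻¹ : Rˣ).1 : K)‖ = 1 := by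
    rw [← norm_mul, ← map_mul, ← MulMemClass.coe_mul, Units.mul_inv]
    simp
  nlinarith [norm_nonneg (algebraMap K L (u.1 : K))]

/-- Two ring homomorphisms that agree up to norm `< 1` on generators do so everywhere. -/
theorem norm_sub_lt_one_of_generators {R A L : Type*} [CommRing R] [CommRing A] [NormedField L]
    [IsUltrametricDist L] {φ : R →+* A} {F : Finset A}
    (hF : letI := φ.toAlgebra; Algebra.adjoin R (F : Set A) = ⊤)
    {b c : A →+* L} (hφ : ∀ r, b (φ r) = c (φ r)) (hc : ∀ x, ‖c x‖ ≤ 1)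
    (h : ∀ x ∈ F, ‖b x - c x‖ < 1) (x : A) : ‖b x - c x‖ < 1 := by
  let := φ.toAlgebra
  have hx : x ∈ Algebra.adjoin R (F : Set A) := hF ▸ trivial
  induction hx using Algebra.adjoin_induction with
  | mem x hx => exact h x hx
  | algebraMap r =>
    rw [show algebraMap R A r = φ r from rfl, hφ, sub_self, norm_zero]
    exact one_pos
  | add x y _ _ hx hy =>
    rw [map_add, map_add, add_sub_add_comm]
    exact (IsUltrametricDist.norm_add_le_max _ _).trans_lt (max_lt hx hy)
  | mul x y _ _ hx hy =>
    -- Integrality of `c` passes to `b`, as they differ by less than `1`.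
    have hbx : ‖b x‖ ≤ 1 := by
      have := IsUltrametricDist.norm_add_le_max (b x - c x) (c x)
      rw [sub_add_cancel] at this
      exact this.trans (max_le hx.le (hc x))
    have : b (x * y) - c (x * y) = b x * (b y - c y) + (b x - c x) * c y := by
      simp only [map_mul]; ring
    rw [this]
    refine (IsUltrametricDist.norm_add_le_max _ _).trans_lt (max_lt ?_ ?_)
    · rw [norm_mul]
      exact (mul_le_of_le_one_left (norm_nonneg _) hbx).trans_lt hy
    · rw [norm_mul]
      exact (mul_le_of_le_one_right (norm_nonneg _) (hc y)).trans_lt hx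

/-! ### The nearby point in charts of the model and of the generic fiber -/

theorem GenericFiberIso.hom_proj_comp {R K : Type u} [CommRing R] [Field K] [Algebra R K]
    {𝒳 : Scheme.{u}} {g : 𝒳 ⟶ Spec (CommRingCat.of R)} {X : Scheme.{u}}
    {f : X ⟶ Spec (CommRingCat.of K)} (e : GenericFiberIso g f) :
    (e.iso.hom ≫ baseChangeProj g K) ≫ g = f ≫ specMap R K := by
  rw [Category.assoc, pullback.condition, ← Category.assoc, e.hom_comp]

theorem genericPt_hom_proj {R K : Type u} [CommRing R] [IsLocalRing R] [Field K] [Algebra R K]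
    {𝒳 : Scheme.{u}} {g : 𝒳 ⟶ Spec (CommRingCat.of R)} {X : Scheme.{u}}
    {f : X ⟶ Spec (CommRingCat.of K)} (e : GenericFiberIso g f) (α : Points g R) :
    (genericPt e α).hom ≫ e.iso.hom ≫ baseChangeProj g K = specMap R K ≫ α.hom := by
  rw [genericPt, Category.assoc, Iso.inv_hom_id_assoc, Points.baseChange, pullback.lift_fst]

/-- In every nonempty open subset of `X` there is an `L`-point, algebraic over `K`, that reduces to
the same point as `α`; it is described in affine charts `i` of `𝒳` and `j` of `X`. -/
theorem exists_near_point {K L : Type u} [Field K] [NormedField L] [CompleteSpace L]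
    [IsUltrametricDist L] [Algebra K L] {R : ValuationSubring K}
    (hR : ∀ x : K, x ∈ R ↔ ‖algebraMap K L x‖ ≤ 1)
    {π : K} (hπ₀ : π ≠ 0) (hπ : ‖algebraMap K L π‖ < 1)
    {X : Scheme.{u}} [IsIntegral X] {f : X ⟶ Spec (CommRingCat.of K)}
    {𝒳 : Scheme.{u}} {g : 𝒳 ⟶ Spec (CommRingCat.of R)} [LocallyOfFiniteType g]
    (e : GenericFiberIso g f) (α : Points g R) (hα : IsSmoothAt f (genericPt e α).pt)
    (O : X.Opens) (hO : (O : Set X).Nonempty) :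
    ∃ (A B : CommRingCat.{u}) (i : Spec A ⟶ 𝒳) (j : Spec B ⟶ X) (φ : CommRingCat.of R ⟶ A)
      (ψ : CommRingCat.of K ⟶ B) (a : A ⟶ CommRingCat.of R) (ρ : A ⟶ B)
      (β : B ⟶ CommRingCat.of L) (h : B),
      i ≫ g = Spec.map φ ∧ j ≫ f = Spec.map ψ ∧ α.hom = Spec.map a ≫ i ∧
      j ≫ e.iso.hom ≫ baseChangeProj g K = Spec.map ρ ≫ i ∧
      φ ≫ ρ = CommRingCat.ofHom (algebraMap R K) ≫ ψ ∧
      ψ ≫ β = CommRingCat.ofHom (algebraMap K L) ∧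
      (∀ x, ‖β (ρ x) - algebraMap K L (a x : R)‖ < 1) ∧
      β h ≠ 0 ∧ (∀ q : Spec B, h ∉ q.asIdeal → j q ∈ O) ∧ ∀ b, IsAlgebraic K (β b) := by
  classical
  obtain ⟨A, φ, i, hi, hig, hφ, hAx⟩ :=
    exists_finiteType_chart g (α.hom (IsLocalRing.closedPoint R))
  obtain ⟨a, ha⟩ := exists_spec_map_of_closedPoint_mem i α.hom hAx
  have hφa : φ ≫ a = 𝟙 _ := by
    apply Spec.map_injective
    rw [Spec.map_comp, ← hig, ← Category.assoc, ← ha, α.hom_comp, specMap_self, Spec.map_id]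
  let p := e.iso.hom ≫ baseChangeProj g K
  have hgp : (genericPt e α).hom ≫ p = specMap R K ≫ α.hom := genericPt_hom_proj e α
  have hxU : (genericPt e α).pt ∈ p ⁻¹ᵁ i.opensRange := by
    change ((genericPt e α).hom ≫ p) _ ∈ Set.range i
    rw [hgp, ha, ← Category.assoc]
    exact ⟨_, (Scheme.Hom.comp_apply _ i _).symm⟩
  obtain ⟨B, ψ, j, hj, hjf, hψ, hBx, hjU⟩ := exists_standardSmooth_chart hα hxU
  have hpr : Set.range (j ≫ p) ⊆ Set.range i := by
    rintro _ ⟨z, rfl⟩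
    rw [Scheme.Hom.comp_apply]
    exact hjU ⟨z, rfl⟩
  obtain ⟨ρ, hρ⟩ : ∃ ρ : A ⟶ B, j ≫ p = Spec.map ρ ≫ i :=
    ⟨Spec.preimage (IsOpenImmersion.lift i _ hpr), by
      rw [Spec.map_preimage, IsOpenImmersion.lift_fac]⟩
  have hφρ : φ ≫ ρ = CommRingCat.ofHom (algebraMap R K) ≫ ψ := by
    apply Spec.map_injective
    rw [Spec.map_comp, ← hig, ← Category.assoc, ← hρ, Category.assoc, e.hom_proj_comp,
      ← Category.assoc, hjf, Spec.map_comp]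
  obtain ⟨aK, haK⟩ := exists_spec_map_of_closedPoint_mem j (genericPt e α).hom hBx
  have hψa : ψ ≫ aK = 𝟙 _ := by
    apply Spec.map_injective
    rw [Spec.map_comp, ← hjf, ← Category.assoc, ← haK, (genericPt e α).hom_comp, specMap_self,
      Spec.map_id]
  have hρa : ρ ≫ aK = a ≫ CommRingCat.ofHom (algebraMap R K) := by
    apply Spec.map_injective
    rw [← cancel_mono i, Spec.map_comp, Category.assoc, ← hρ, ← Category.assoc, ← haK, hgp,
      Spec.map_comp, Category.assoc, ← ha]
  -- `X` is irreducible, so `O` meets the chart around `ι(α)`.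
  obtain ⟨x, hx⟩ : ((j ⁻¹ᵁ O : (Spec B).Opens) : Set (Spec B)).Nonempty := by
    have hr : (Set.range j).Nonempty := ⟨_, hBx⟩
    obtain ⟨_, ⟨z, rfl⟩, hz⟩ := nonempty_preirreducible_inter j.isOpenEmbedding.isOpen_range
      O.isOpen hr hO
    exact ⟨z, hz⟩
  obtain ⟨_, ⟨h, rfl⟩, hxh, hhO⟩ :=
    PrimeSpectrum.isTopologicalBasis_basic_opens.exists_subset_of_mem_open hx (j ⁻¹ᵁ O).isOpen
  have : Nonempty (Spec B) := ⟨x⟩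
  have : IsIntegral (Spec B) := isIntegral_of_isOpenImmersion j
  have : IsDomain B := (affine_isIntegral_iff B).1 this
  have hh : h ≠ 0 := by
    rintro rfl
    exact hxh x.asIdeal.zero_mem
  let : Algebra K B := ψ.hom.toAlgebra
  have : Algebra.IsStandardSmooth K B := hψ
  let α' : B →ₐ[K] K := { aK.hom with commutes' := fun r => congr($hψa r) }
  obtain ⟨F, hF⟩ := hφ
  -- Closeness is only requested on the images of generators of `A`, with `ε = 1`, the bound that
  -- detects the maximal ideal.
  obtain ⟨β, hβF, hβh, hβalg⟩ := exists_algHom_near (L := L) π hπ₀ hπ α' (F.image ρ) one_pos hh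
  refine ⟨A, B, i, j, φ, ψ, a, ρ, CommRingCat.ofHom β.toRingHom, h, hig, hjf, ha, hρ, hφρ, ?_,
    ?_, hβh, fun q hq => hhO hq, hβalg⟩
  · ext r
    exact β.commutes r
  · have hk : ∀ x, α' (ρ x) = algebraMap R K (a x) := fun x => congr($hρa x)
    refine norm_sub_lt_one_of_generators (φ := φ.hom) (b := β.toRingHom.comp ρ.hom)
      (c := ((algebraMap K L).comp (algebraMap R K)).comp a.hom) hF ?_ ?_ ?_
    · intro r
      have h1 : ρ (φ r) = ψ (algebraMap R K r) := congr($hφρ r)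
      have h2 : a (φ r) = r := congr($hφa r)
      change β (ρ (φ r)) = algebraMap K L (algebraMap R K (a (φ r)))
      rw [h1, h2]
      exact β.commutes _
    · exact fun x => (hR _).1 (a x : R).2
    · intro x hx
      have := hβF _ (Finset.mem_image_of_mem ρ hx)
      rw [hk] at this
      exact this

/-! ### The two density statements -/

theorem mem_closedPoint_field {L : Type u} [Field L] {x : L} :
    x ∈ (IsLocalRing.closedPoint L).asIdeal ↔ x = 0 := by
  change x ∈ IsLocalRing.maximalIdeal L ↔ _
  rw [IsLocalRing.maximalIdeal_eq_bot, Ideal.mem_bot]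

/-- The component of a reduction along `Spec` of the residue field is the identity, so only its
projection to `𝒳` matters. -/
theorem reduction_eq_iff {R : Type u} [CommRing R] [IsLocalRing R] {𝒳 : Scheme.{u}}
    {g : 𝒳 ⟶ Spec (CommRingCat.of R)} {α β : Points g R} :
    reduction α = reduction β ↔ specMap R (IsLocalRing.ResidueField R) ≫ α.hom =
      specMap R (IsLocalRing.ResidueField R) ≫ β.hom := by
  refine ⟨fun h => ?_, fun h => Points.ext ?_⟩
  · simpa only [Points.baseChange, pullback.lift_fst] using
      congr(($h).hom ≫ baseChangeProj g (IsLocalRing.ResidueField R))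
  · simp only [Points.baseChange, h]

theorem genericPt_eq_of_comp_eq {R K : Type u} [CommRing R] [IsLocalRing R] [Field K] [Algebra R K]
    {𝒳 : Scheme.{u}} {g : 𝒳 ⟶ Spec (CommRingCat.of R)} {X : Scheme.{u}}
    {f : X ⟶ Spec (CommRingCat.of K)} {e : GenericFiberIso g f} {α : Points g R} {y : Points f K}
    (h : y.hom ≫ e.iso.hom ≫ baseChangeProj g K = specMap R K ≫ α.hom) : genericPt e α = y := by
  refine Points.ext ?_
  rw [← cancel_mono e.iso.hom]
  refine pullback.hom_ext ?_ ?_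
  · rw [Category.assoc, Category.assoc, h, genericPt_hom_proj]
  · rw [Category.assoc, Category.assoc, e.hom_comp, (genericPt e α).hom_comp, y.hom_comp]

theorem isZariskiDense_residueClass {K : Type u} [NormedField K] [CompleteSpace K]
    [IsUltrametricDist K] {R : ValuationSubring K} (hR : ∀ x : K, x ∈ R ↔ ‖x‖ ≤ 1)
    {π : K} (hπ₀ : π ≠ 0) (hπ : ‖π‖ < 1)
    {X : Scheme.{u}} [IsIntegral X] {f : X ⟶ Spec (CommRingCat.of K)}
    {𝒳 : Scheme.{u}} {g : 𝒳 ⟶ Spec (CommRingCat.of R)} [LocallyOfFiniteType g]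
    (e : GenericFiberIso g f) (α : Points g R) (hα : IsSmoothAt f (genericPt e α).pt) :
    IsZariskiDense (genericPt e '' residueClass α) := by
  refine dense_iff_inter_open.2 fun O hO hne => ?_
  obtain ⟨A, B, i, j, φ, ψ, a, ρ, β, h, hig, hjf, ha, hρ, hφρ, hψβ, hnear, hh, hjO, -⟩ :=
    exists_near_point (L := K) hR hπ₀ hπ e α hα ⟨O, hO⟩ hne
  -- By the ultrametric inequality `β ∘ ρ` is integral, hence factors through `R` and defines an
  -- `R`-point of `𝒳`.
  have hint : ∀ x, β (ρ x) ∈ R := fun x => by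
    rw [hR, ← sub_add_cancel (β (ρ x)) (a x : R)]
    exact (IsUltrametricDist.norm_add_le_max _ _).trans (max_le (hnear x).le ((hR _).1 (a x : R).2))
  let b : A ⟶ CommRingCat.of R :=
    CommRingCat.ofHom ((β.hom.comp ρ.hom).codRestrict R.toSubring hint)
  have hb : b ≫ CommRingCat.ofHom (algebraMap R K) = ρ ≫ β := rfl
  have hφb : φ ≫ b = 𝟙 _ := by
    refine CommRingCat.hom_ext (RingHom.ext fun r => Subtype.ext ?_)
    change (φ ≫ ρ ≫ β) r = (r : K)
    rw [← Category.assoc, hφρ, Category.assoc, hψβ]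
    rfl
  let α' : Points g R := ⟨Spec.map b ≫ i, by
    rw [Category.assoc, hig, ← Spec.map_comp, hφb, specMap_self, Spec.map_id]⟩
  let y : Points f K := ⟨Spec.map β ≫ j, by
    rw [Category.assoc, hjf, ← Spec.map_comp, hψβ]⟩
  have hy : genericPt e α' = y := genericPt_eq_of_comp_eq <| by
    change (Spec.map β ≫ j) ≫ _ = _ ≫ Spec.map b ≫ i
    rw [Category.assoc, hρ, ← Spec.map_comp_assoc, ← Spec.map_comp_assoc, hb]
  refine ⟨y.pt, ?_, ⟨y, ⟨α', ?_, hy⟩, rfl⟩⟩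
  · change (Spec.map β ≫ j) (IsLocalRing.closedPoint K) ∈ O
    refine (Scheme.Hom.comp_apply _ j _).symm ▸ hjO _ fun hmem => hh ?_
    exact mem_closedPoint_field.1 hmem
  · refine reduction_eq_iff.2 ?_
    rw [ha, ← Spec.map_comp_assoc, ← Spec.map_comp_assoc]
    congr 2
    ext x
    change IsLocalRing.residue R (a x) = IsLocalRing.residue R (b x)
    rw [← sub_eq_zero, ← map_sub, IsLocalRing.residue_eq_zero_iff]
    refine mem_maximalIdeal_of_norm_lt_one (L := K) hR ?_
    have := hnear x
    rw [norm_sub_rev] at this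
    exact this

theorem isZariskiDense_specializingPoints {K L : Type u} [Field K] [NormedField L]
    [CompleteSpace L] [IsUltrametricDist L] [Algebra K L] {R : ValuationSubring K}
    (hR : ∀ x : K, x ∈ R ↔ ‖algebraMap K L x‖ ≤ 1)
    {π : K} (hπ₀ : π ≠ 0) (hπ : ‖algebraMap K L π‖ < 1)
    {X : Scheme.{u}} [IsIntegral X] {f : X ⟶ Spec (CommRingCat.of K)}
    {𝒳 : Scheme.{u}} {g : 𝒳 ⟶ Spec (CommRingCat.of R)} [LocallyOfFiniteType g]
    (e : GenericFiberIso g f) (α : Points g R) (hα : IsSmoothAt f (genericPt e α).pt) :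
    IsZariskiDense (specializingPoints e α (AlgebraicClosure K)) := by
  refine dense_iff_inter_open.2 fun O hO hne => ?_
  obtain ⟨A, B, i, j, φ, ψ, a, ρ, β, h, hig, hjf, ha, hρ, hφρ, hψβ, hnear, hh, hjO, halg⟩ :=
    exists_near_point hR hπ₀ hπ e α hα ⟨O, hO⟩ hne
  let β₀ : B →+* algebraicClosure K L :=
    β.hom.codRestrict (algebraicClosure K L).toSubring fun x => mem_algebraicClosure_iff.2 (halg x)
  -- The coordinates are moved from `L` into the fixed algebraic closure of `K`; `τ` is injective,
  -- so no kernel changes.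
  let τ : algebraicClosure K L →ₐ[K] AlgebraicClosure K := IsAlgClosed.lift
  let γ : B ⟶ CommRingCat.of (AlgebraicClosure K) := CommRingCat.ofHom (τ.toRingHom.comp β₀)
  have hγ : ∀ x, γ x = 0 → β x = 0 := fun x hx => by
    have : β₀ x = 0 := τ.injective (hx.trans (map_zero τ).symm)
    exact congrArg Subtype.val this
  have hψγ : ψ ≫ γ = CommRingCat.ofHom (algebraMap K (AlgebraicClosure K)) := by
    ext r
    change τ (β₀ (ψ r)) = algebraMap K (AlgebraicClosure K) r
    rw [← τ.commutes]
    congr 1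
    exact Subtype.ext congr($hψβ r)
  let y : Points f (AlgebraicClosure K) := ⟨Spec.map γ ≫ j, by
    rw [Category.assoc, hjf, ← Spec.map_comp, hψγ]⟩
  refine ⟨y.pt, ?_, ⟨y, ?_, rfl⟩⟩
  · change (Spec.map γ ≫ j) (IsLocalRing.closedPoint (AlgebraicClosure K)) ∈ O
    refine (Scheme.Hom.comp_apply _ j _).symm ▸ hjO _ fun hmem => hh (hγ _ ?_)
    exact mem_closedPoint_field.1 hmem
  · let k := IsLocalRing.ResidueField R
    have h1 : baseChangeProj g k (reduction α).pt =
        i (Spec.map (a ≫ CommRingCat.ofHom (algebraMap R k)) (IsLocalRing.closedPoint k)) := by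
      have : (reduction α).hom ≫ baseChangeProj g k =
          Spec.map (a ≫ CommRingCat.ofHom (algebraMap R k)) ≫ i :=
        (pullback.lift_fst _ _ _).trans <| by rw [ha, Spec.map_comp, Category.assoc]
      exact congr($this (IsLocalRing.closedPoint k))
    have h2 : baseChangeProj g K (e.iso.hom y.pt) =
        i (Spec.map (ρ ≫ γ) (IsLocalRing.closedPoint (AlgebraicClosure K))) := by
      have : y.hom ≫ e.iso.hom ≫ baseChangeProj g K = Spec.map (ρ ≫ γ) ≫ i := by
        change (Spec.map γ ≫ j) ≫ _ = _
        rw [Category.assoc, hρ, Spec.map_comp, Category.assoc]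
      exact congr($this (IsLocalRing.closedPoint (AlgebraicClosure K)))
    change baseChangeProj g k (reduction α).pt ∈ closure {baseChangeProj g K (e.iso.hom y.pt)}
    rw [← specializes_iff_mem_closure, h1, h2]
    -- In the chart `Spec A` the specialization is an inclusion of primes: if `β (ρ x) = 0` then `a
    -- x` has norm `< 1`, hence zero residue.
    refine Specializes.map ((PrimeSpectrum.le_iff_specializes _ _).1 fun x hx => ?_) i.continuous
    have hx0 : β (ρ x) = 0 := hγ _ (mem_closedPoint_field.1 hx)
    refine mem_closedPoint_field.2 ?_
    change IsLocalRing.residue R (a x) = 0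
    rw [IsLocalRing.residue_eq_zero_iff]
    refine mem_maximalIdeal_of_norm_lt_one (L := L) hR ?_
    have := hnear x
    rwa [hx0, zero_sub, norm_neg] at this

/-! ### Finite extensions of `ℚ_[p]` and completions of number fields -/

theorem exists_norm_lt_one (p : ℕ) [Fact p.Prime] (K : Type u) [NormedField K]
    [NormedAlgebra ℚ_[p] K] : ∃ π : K, π ≠ 0 ∧ ‖π‖ < 1 := by
  refine ⟨algebraMap ℚ_[p] K p, ?_, ?_⟩
  · rw [Ne, map_eq_zero]
    exact_mod_cast (Fact.out : p.Prime).ne_zero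
  · rw [norm_algebraMap']
    exact Padic.norm_p_lt_one

/-- The norm is the `v`-adic valuation with the absolute norm of `v` as base; this base exceeds `1`,
so both conditions `≤ 1` agree. -/
theorem mem_valuationSubringAtPrime_iff {K : Type u} [Field K] [NumberField K]
    (v : IsDedekindDomain.HeightOneSpectrum (NumberField.RingOfIntegers K)) (x : K) :
    x ∈ IsDedekindDomain.HeightOneSpectrum.valuationSubringAtPrime K v ↔
      ‖algebraMap K (v.adicCompletion K) x‖ ≤ 1 := by
  rw [IsDedekindDomain.HeightOneSpectrum.valuationSubringAtPrime_eq_valuationSubring,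
    Valuation.mem_valuationSubring_iff]
  change _ ↔ ‖NumberField.FinitePlace.embedding v x‖ ≤ 1
  rw [NumberField.FinitePlace.norm_embedding']
  exact_mod_cast (WithZeroMulInt.toNNReal_le_one_iff
    (NumberField.HeightOneSpectrum.one_lt_absNorm_nnreal v)).symm

theorem exists_norm_adicCompletion_lt_one {K : Type u} [Field K] [NumberField K]
    (v : IsDedekindDomain.HeightOneSpectrum (NumberField.RingOfIntegers K)) :
    ∃ π : K, π ≠ 0 ∧ ‖algebraMap K (v.adicCompletion K) π‖ < 1 := by
  obtain ⟨x, hx, hx0⟩ := Submodule.exists_mem_ne_zero_of_ne_bot v.ne_bot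
  refine ⟨algebraMap _ K x, by simpa using hx0, ?_⟩
  exact (NumberField.FinitePlace.norm_lt_one_iff_mem K v x).2 hx

end DenseResidueClass

end

theorem proposition2p2 :
    -- Local version: `K` is a finite extension of `ℚ_p` with its absolute value.
    (∀ (p : ℕ) [Fact p.Prime] (K : Type u) [NormedField K] [IsUltrametricDist K]
        [NormedAlgebra ℚ_[p] K] [FiniteDimensional ℚ_[p] K]
        (X : Scheme.{u}) (f : X ⟶ Spec (CommRingCat.of K))
        (_ : DenseResidueClass.IsQuasiProjectiveVariety f)
        (𝒳 : Scheme.{u})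
        (g : 𝒳 ⟶ Spec (CommRingCat.of (NormedField.valuation (K := K)).valuationSubring))
        (_ : LocallyOfFiniteType g)
        (e : DenseResidueClass.GenericFiberIso g f)
        (α : DenseResidueClass.Points g (NormedField.valuation (K := K)).valuationSubring)
        (_ : DenseResidueClass.IsSmoothAt f (DenseResidueClass.genericPt e α).pt),
        DenseResidueClass.IsZariskiDense
          (DenseResidueClass.genericPt e '' DenseResidueClass.residueClass α)) ∧
    -- Global version: `K` is a number field and `v` a nonarchimedean place of `K`.
    (∀ (K : Type u) [Field K] [NumberField K]
        (v : IsDedekindDomain.HeightOneSpectrum (NumberField.RingOfIntegers K))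
        (X : Scheme.{u}) (f : X ⟶ Spec (CommRingCat.of K))
        (_ : DenseResidueClass.IsQuasiProjectiveVariety f)
        (𝒳 : Scheme.{u})
        (g : 𝒳 ⟶ Spec (CommRingCat.of
          (IsDedekindDomain.HeightOneSpectrum.valuationSubringAtPrime K v)))
        (_ : LocallyOfFiniteType g)
        (e : DenseResidueClass.GenericFiberIso g f)
        (α : DenseResidueClass.Points g
          (IsDedekindDomain.HeightOneSpectrum.valuationSubringAtPrime K v))
        (_ : DenseResidueClass.IsSmoothAt f (DenseResidueClass.genericPt e α).pt),
        DenseResidueClass.IsZariskiDense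
          (DenseResidueClass.specializingPoints e α (AlgebraicClosure K))) := by
  refine ⟨?_, ?_⟩
  · intro p _ K _ _ _ _ X f hX 𝒳 g _ e α hα
    have := hX.isIntegral
    have : CompleteSpace K := FiniteDimensional.complete ℚ_[p] K
    obtain ⟨π, hπ₀, hπ⟩ := DenseResidueClass.exists_norm_lt_one p K
    exact DenseResidueClass.isZariskiDense_residueClass (fun _ => Iff.rfl) hπ₀ hπ e α hα
  · intro K _ _ v X f hX 𝒳 g _ e α hα
    have := hX.isIntegral
    obtain ⟨π, hπ₀, hπ⟩ := DenseResidueClass.exists_norm_adicCompletion_lt_one v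
    exact DenseResidueClass.isZariskiDense_specializingPoints
      (DenseResidueClass.mem_valuationSubringAtPrime_iff v) hπ₀ hπ e α hα
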